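/- Let $\mathbb F$ be any field. For $n\ge 1$ and $d\ge 0$ consider polynomials in the noncommuting variables $x_1,\dots,x_n$ over $\mathbb F$. For $f$ homogeneous of even degree $d$, let $M_{d/2}(f)$ be the $n^{d/2}\times n^{d/2}$ matrix whose rows and columns are indexed by the monomials of degree $d/2$ and whose entry at $(u,v)$ is the coefficient of $uv$ in $f$; call $f$ *$d$-full-rank* if $M_{d/2}(f)$ has rank $n^{d/2}$. For a polynomial $h$ let $h^{(i)}$ denote its homogeneous part of degree $i$. An *algebraic branching program (ABP) with help polynomials* $h_1,\dots,h_m\in\mathbb F\langle x_1,\dots,x_n\rangle$ is a finite directed acyclic graph with a source $s$ and a sink $t$, each edge $e$ of which is labelled by a linear form $\sum_i\alpha_i x_i+\sum_j\beta_j y_j$; put $L'(e)=\sum_i\alpha_i x_i+\sum_j\beta_j h_j$. The ABP computes $\sum_{\gamma}\prod_{e\in\gamma}L'(e)$, where $\gamma$ runs over the paths from $s$ to $t$ and the product is taken in the order of the path. Its size is the number of vertices. **Theorem.** There is a family of polynomials $F_{n,d}\in\mathbb F\langle x_1,\dots,x_n\rangle$, for $n\ge1$ and even $d\ge2$, with $F_{n,d}$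 homogeneous of degree $d$ and $d$-full-rank, such that the following two statements hold. 1. *(Explicitness.)* All coefficients of $F_{n,d}$ are $0$ or $1$, and there is a single Turing machine that, given $n$ and $d$ in unary, writes down the list of the $n^d$ coefficients of the monomials of degree $d$ in $F_{n,d}$ in a number of steps polynomial in $n+d+n^d$. 2. *(Lower bound.)* Let $n\ge1$, let $d\ge2$ be even, let $m\ge1$, let $h_1,\dots,h_m\in\mathbb F\langle x_1,\dots,x_n\rangle$ be arbitrary, and let $0<\varepsilon\le1$. Suppose that every nonzero homogeneous part $h_j^{(i)}$ with $1\le j\le m$ and $2\le i\le d$ has degree $i\le(1-\varepsilon)d$. Then every ABP with help polynomials $h_1,\dots,h_m$ that computes $F_{n,d}$ has size at least $$\frac{n^{\varepsilon d/4}}{\sqrt{2m}\,d(d+1)}.$$ -/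

import Mathlib

/-- The ring of polynomials over `K` in the `n` noncommuting variables `x_0, …, x_{n-1}`: finite
`K`-linear combinations of words (elements of the free monoid), multiplied by concatenation. -/
abbrev NCPoly (K : Type*) [Field K] (n : ℕ) : Type _ :=
  MonoidAlgebra K (FreeMonoid (Fin n))

namespace NCPoly

variable {K : Type*} [Field K] {n : ℕ}

/-- The variable `x_i`. -/
noncomputable def X (i : Fin n) : NCPoly K n :=
  MonoidAlgebra.single (FreeMonoid.of i) 1

/-- The monomial `x_{w 0} x_{w 1} ⋯ x_{w (k-1)}` of degree `k`. -/
def word {k : ℕ} (w : Fin k → Fin n) : FreeMonoid (Fin n) :=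
  FreeMonoid.ofList (List.ofFn w)

/-- All monomials occurring in `f` have degree `d`. -/
def IsHomogeneous (f : NCPoly K n) (d : ℕ) : Prop :=
  ∀ w : FreeMonoid (Fin n), f.coeff w ≠ 0 → w.length = d

/-- The homogeneous part of degree `i` of `f`. -/
noncomputable def homogeneousPart (f : NCPoly K n) (i : ℕ) : NCPoly K n :=
  MonoidAlgebra.ofCoeff (f.coeff.filter fun w => w.length = i)

/-- The matrix `M_k(f)` (for polynomials `f` of degree `d`): rows are indexed by the monomials of
degree `k`, columns by the monomials of degree `d - k`, and the entry at `(u, v)` is the coefficient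
of `u v` in `f`. -/
def commMatrix (f : NCPoly K n) (d k : ℕ) :
    Matrix (Fin k → Fin n) (Fin (d - k) → Fin n) K :=
  Matrix.of fun u v => f.coeff (word u * word v)

/-- `f` is `d`-full-rank (for even `d`): it is homogeneous of degree `d` and
`rank M_{d/2}(f) = n^{d/2}`. -/
def IsFullRank (f : NCPoly K n) (d : ℕ) : Prop :=
  f.IsHomogeneous d ∧ (f.commMatrix d (d / 2)).rank = n ^ (d / 2)

end NCPoly

/-- An algebraic branching program with `m` help polynomials over the variables `x_0, …, x_{n-1}`:
a directed acyclic graph on the vertex set `Fin size` with a source and a sink, in which every edge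
`(u, v)` carries a linear form `∑ i, α_i x_i + ∑ j, β_j y_j`. Edges lead from lower to higher levels;
this is exactly acyclicity, and it includes the layered graphs in which every edge leads from one
level to the next. The labels `xCoeff u v`, `yCoeff u v` matter only if `(u, v)` is an edge. -/
structure HelpABP (K : Type*) [Field K] (n m : ℕ) where
  /-- the number of vertices -/
  size : ℕ
  /-- the edges -/
  Adj : Fin size → Fin size → Prop
  /-- the level of a vertex -/
  level : Fin size → ℕ
  /-- edges lead to higher levels -/
  level_lt : ∀ u v, Adj u v → level u < level v
  /-- the source -/
  source : Fin size
  /-- the sink -/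
  sink : Fin size
  /-- the coefficients `α_i` of the labels -/
  xCoeff : Fin size → Fin size → Fin n → K
  /-- the coefficients `β_j` of the labels -/
  yCoeff : Fin size → Fin size → Fin m → K

namespace HelpABP

variable {K : Type*} [Field K] {n m : ℕ}

/-- The polynomial of the edge `(u, v)`: the help polynomial `h j` is substituted for `y_j` in its
label. -/
noncomputable def edgePoly (A : HelpABP K n m) (h : Fin m → NCPoly K n)
    (u v : Fin A.size) : NCPoly K n :=
  ∑ i, A.xCoeff u v i • NCPoly.X i + ∑ j, A.yCoeff u v j • h j

/-- `p 0, p 1, …, p l` are the successive vertices of a path with `l` edges from `u` to `v`. -/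
def IsPath (A : HelpABP K n m) (u v : Fin A.size) {l : ℕ} (p : Fin (l + 1) → Fin A.size) : Prop :=
  p 0 = u ∧ p (Fin.last l) = v ∧ ∀ i : Fin l, A.Adj (p i.castSucc) (p i.succ)

/-- Every path has fewer edges than the program has vertices. -/
theorem IsPath.length_lt {A : HelpABP K n m} {u v : Fin A.size} {l : ℕ}
    {p : Fin (l + 1) → Fin A.size} (hp : A.IsPath u v p) : l < A.size := by
  have hmono : StrictMono fun i => A.level (p i) :=
    Fin.strictMono_iff_lt_succ.2 fun i => A.level_lt _ _ (hp.2.2 i)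
  have hinj : Function.Injective p := fun a b hab =>
    hmono.injective (congrArg A.level hab)
  simpa using Fintype.card_le_of_injective p hinj

/-- The product `L'(e_1) L'(e_2) ⋯ L'(e_l)`, in this order, of the polynomials of the edges of a
path. -/
noncomputable def pathPoly (A : HelpABP K n m) (h : Fin m → NCPoly K n) {l : ℕ}
    (p : Fin (l + 1) → Fin A.size) : NCPoly K n :=
  (List.ofFn fun i : Fin l => A.edgePoly h (p i.castSucc) (p i.succ)).prod

open Classical in
/-- The polynomial computed from `u` to `v`: the sum of the polynomials of all paths from `u` to
`v`. By `IsPath.length_lt` it suffices to let the number `l` of edges run below `size`. -/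
noncomputable def polyBetween (A : HelpABP K n m) (h : Fin m → NCPoly K n)
    (u v : Fin A.size) : NCPoly K n :=
  ∑ l ∈ Finset.range A.size,
    ∑ p : Fin (l + 1) → Fin A.size with A.IsPath u v p, A.pathPoly h p

/-- `A` computes `f` when it uses the help polynomials `h`. -/
def Computes (A : HelpABP K n m) (h : Fin m → NCPoly K n) (f : NCPoly K n) : Prop :=
  A.polyBetween h A.source A.sink = f

end HelpABP

namespace NCPoly

/-- The input word `1^n 0 1^d` given to a machine that has to write down the coefficients of the
member of a family with parameters `n` and `d`. -/
def unaryPair (n d : ℕ) : List Bool :=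
  List.replicate n true ++ false :: List.replicate d true

/-- A family `F n d` of homogeneous polynomials of degree `d` in `n` variables, for `n ≥ 1` and even
`d ≥ 2`, is explicit: its coefficients are `0` or `1`, and one Turing machine, given `n` and `d`,
writes down the list of the `n ^ d` coefficients of the monomials of degree `d` in a number of steps
polynomial in the total length of the input and the output. The `k`-th monomial in the list is the
one whose indices are the `d` digits of `k` in base `n` (lowest digit first). The machine does not
depend on `n` and `d`. -/
def IsExplicitFamily {K : Type*} [Field K] (F : ∀ n _d : ℕ, NCPoly K n) : Prop :=
  ∃ (M : Turing.TM2ComputableAux Bool Bool) (time : Polynomial ℕ),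
    ∀ n d : ℕ, 1 ≤ n → 2 ≤ d → Even d →
      (F n d).IsHomogeneous d ∧
      ∃ b : Fin (n ^ d) → Bool,
        (∀ k, (F n d).coeff (word (finFunctionFinEquiv.symm k)) = if b k then 1 else 0) ∧
        Nonempty (Turing.TM2OutputsInTime M.tm
          ((unaryPair n d).map M.inputAlphabet.symm)
          (some ((List.ofFn b).map M.outputAlphabet.symm))
          (time.eval ((unaryPair n d).length + n ^ d)))

end NCPoly

/-! The polynomial is the sum of all squares `u u` of monomials of degree `d / 2`, so its middle
coefficient matrix is the identity.

For the lower bound, let `E` be the weighted adjacency matrix of a program. It is nilpotent, and `G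
= ∑ E ^ l = (1 - E)⁻¹` collects the polynomials computed between pairs of vertices. In a product
along a path that contributes to a word of length at least `k`, exactly one edge takes the degree of
the prefix from below `k` to at least `k`. Sorting by the endpoints of this edge and by the
positions `a < k ≤ i` where its subword begins and ends (`coeffList_inverse_split`) writes the
coefficient matrix as a sum of at most `k (d - k + 1) size ^ 2` terms. Each term is a product of
three coefficients, and only the middle one couples rows to columns, through `k - a` letters of the
row index and `i - k` letters of the column index. Its rank is therefore at most `n ^ ((i - a) / 2)`
(`rank_split_le`). A nonzero middle coefficient of degree `i - a ≥ 2` must come from a help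
polynomial, hence `i - a ≤ (1 - ε) d`. Comparing with the full rank `n ^ (d / 2)` bounds `size ^ 2`
from below.

Explicitness holds because the coefficient list, read along base-`n` numerals, is an identity matrix
of size `n ^ (d / 2)` row by row: its ones stand at equally spaced positions, so a stack machine can
print it with unary counters. -/

/-! ### A machine that writes down an identity matrix of size `n ^ (d / 2)` -/

namespace IdentityPrinter

open Turing TM2.Stmt

/-- The stacks: input, the base `n`, two scratch counters, the current power of `n`, output. -/
inductive Stack
  | inp | base | tmp | acc | pow | out
  deriving DecidableEq

instance : Fintype Stack :=
  ⟨{.inp, .base, .tmp, .acc, .pow, .out}, by rintro (_ | _) <;> decide⟩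

/-- The labels of the program. -/
inductive Label
  | read | power | mul | add | restore | refill | clear | copy | row | zeros | back | wipe
  deriving DecidableEq

instance : Fintype Label :=
  ⟨{.read, .power, .mul, .add, .restore, .refill, .clear, .copy, .row, .zeros, .back, .wipe}, by
    rintro (_ | _) <;> decide⟩

/-- Pop the stack `k`; continue with `q` if it was nonempty and go to `l` otherwise. -/
def popOr (k : Stack) (l : Label) (q : TM2.Stmt (fun _ : Stack => Bool) Label (Option Bool)) :
    TM2.Stmt (fun _ : Stack => Bool) Label (Option Bool) :=
  pop k (fun _ x => x) <| branch Option.isSome q (load (fun _ => none) <| goto fun _ => l)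

/-- Forget the last symbol that was read and go to `l`. -/
def jump (l : Label) : TM2.Stmt (fun _ : Stack => Bool) Label (Option Bool) :=
  load (fun _ => none) <| goto fun _ => l

/-- The program. It reads `n` in unary into `base`, multiplies `pow` by `n` for every two symbols
of the remaining input, and then prints the rows of an identity matrix of size `pow`. -/
def program : Label → TM2.Stmt (fun _ : Stack => Bool) Label (Option Bool)
  | .read => pop .inp (fun _ x => x) <|
      branch (fun x => x == some true) (push .base (fun _ => true) <| jump .read)
        (push .pow (fun _ => true) <| jump .power)
  | .power => popOr .inp .clear <| pop .inp (fun _ x => x) <| jump .mul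
  | .mul => popOr .pow .refill <| jump .add
  | .add => popOr .base .restore <|
      push .tmp (fun _ => true) <| push .acc (fun _ => true) <| jump .add
  | .restore => popOr .tmp .mul <| push .base (fun _ => true) <| jump .restore
  | .refill => popOr .acc .power <| push .pow (fun _ => true) <| jump .refill
  | .clear => popOr .base .copy <| jump .clear
  | .copy => popOr .pow .row <|
      push .tmp (fun _ => true) <| push .acc (fun _ => true) <| jump .copy
  | .row => pop .acc (fun _ x => x) <| push .out (fun _ => true) <|
      peek .acc (fun _ x => x) <| branch Option.isSome (jump .zeros) (jump .wipe)
  | .zeros => popOr .tmp .back <|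
      push .pow (fun _ => true) <| push .out (fun _ => false) <| jump .zeros
  | .back => popOr .pow .row <| push .tmp (fun _ => true) <| jump .back
  | .wipe => pop .tmp (fun _ x => x) <|
      branch Option.isSome (jump .wipe) (load (fun _ => none) halt)

/-- The machine. -/
def machine : FinTM2 where
  K := Stack
  k₀ := .inp
  k₁ := .out
  Γ := fun _ => Bool
  Λ := Label
  main := .read
  σ := Option Bool
  initialState := none
  Γk₀Fin := inferInstanceAs (Fintype Bool)
  m := program

/-- The configuration with given label, input and output stacks, and counters. -/
def conf (l : Option Label) (i : List Bool) (a b c p : ℕ) (o : List Bool) : machine.Cfg where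
  l := l
  var := none
  stk := fun k => match k with
    | .inp => i
    | .base => List.replicate a true
    | .tmp => List.replicate b true
    | .acc => List.replicate c true
    | .pow => List.replicate p true
    | .out => o

/-- The machine gets from `x` to `y` in at most `t` steps. -/
def Run (t : ℕ) (x y : machine.Cfg) : Prop :=
  Nonempty (StateTransition.EvalsToInTime machine.step x (some y) t)

theorem Run.trans {s t : ℕ} {x y z : machine.Cfg} : Run s x y → Run t y z → Run (s + t) x z := by
  rintro ⟨h⟩ ⟨h'⟩
  exact ⟨add_comm t s ▸ StateTransition.EvalsToInTime.trans _ _ _ _ _ _ h h'⟩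

theorem Run.mono {s t : ℕ} {x y : machine.Cfg} (hst : s ≤ t) : Run s x y → Run t x y := by
  rintro ⟨h⟩
  exact ⟨⟨h.toEvalsTo, h.steps_le_m.trans hst⟩⟩

theorem Run.of_step {x y : machine.Cfg} (h : machine.step x = some y) : Run 1 x y :=
  ⟨⟨⟨1, h⟩, le_rfl⟩⟩

theorem Run.cons {t : ℕ} {x y z : machine.Cfg} (h : Run t y z) (hxy : Run 1 x y) :
    Run (t + 1) x z :=
  (hxy.trans h).mono (add_comm 1 t).le

theorem cfg_ext {x y : machine.Cfg} (hl : x.l = y.l) (hv : x.var = y.var)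
    (hs : ∀ k, x.stk k = y.stk k) : x = y := by
  obtain ⟨l, v, s⟩ := x
  obtain ⟨l', v', s'⟩ := y
  obtain rfl : l = l' := hl
  obtain rfl : v = v' := hv
  obtain rfl : s = s' := funext hs
  rfl

/-- Every branch of the program resets the register to `none`, so a single step between standard
configurations is a computation. Stacks are compared one at a time: an updated stack function agrees
with the literal `match` only after a case split on the stack. -/
theorem run_of_stepAux {l : Label} {i : List Bool} {a b c p : ℕ} {o : List Bool} {y : machine.Cfg}
    (hl : (TM2.stepAux (program l) none (conf (some l) i a b c p o).stk).l = y.l)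
    (hv : (TM2.stepAux (program l) none (conf (some l) i a b c p o).stk).var = y.var)
    (hs : ∀ k, (TM2.stepAux (program l) none (conf (some l) i a b c p o).stk).stk k = y.stk k) :
    Run 1 (conf (some l) i a b c p o) y :=
  Run.of_step (congrArg some (cfg_ext hl hv hs))

theorem run_read (n : ℕ) (i : List Bool) (a b c p : ℕ) (o : List Bool) :
    Run (n + 1) (conf (some .read) (List.replicate n true ++ false :: i) a b c p o)
      (conf (some .power) i (a + n) b c (p + 1) o) := by
  induction n generalizing a with
  | zero => exact run_of_stepAux rfl rfl (by rintro (_ | _) <;> rfl)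
  | succ n ih =>
    have h := ih (a + 1)
    rw [Nat.add_right_comm a 1 n] at h
    exact h.cons (run_of_stepAux rfl rfl (by rintro (_ | _) <;> rfl))

theorem run_add (i : List Bool) (a b c p : ℕ) (o : List Bool) :
    Run (a + 1) (conf (some .add) i a b c p o)
      (conf (some .restore) i 0 (b + a) (c + a) p o) := by
  induction a generalizing b c with
  | zero => exact run_of_stepAux rfl rfl (by rintro (_ | _) <;> rfl)
  | succ a ih =>
    have h := ih (b + 1) (c + 1)
    rw [Nat.add_right_comm b 1 a, Nat.add_right_comm c 1 a] at h
    exact h.cons (run_of_stepAux rfl rfl (by rintro (_ | _) <;> rfl))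

theorem run_restore (i : List Bool) (a b c p : ℕ) (o : List Bool) :
    Run (b + 1) (conf (some .restore) i a b c p o) (conf (some .mul) i (a + b) 0 c p o) := by
  induction b generalizing a with
  | zero => exact run_of_stepAux rfl rfl (by rintro (_ | _) <;> rfl)
  | succ b ih =>
    have h := ih (a + 1)
    rw [Nat.add_right_comm a 1 b] at h
    exact h.cons (run_of_stepAux rfl rfl (by rintro (_ | _) <;> rfl))

theorem run_mul (i : List Bool) (a c p : ℕ) (o : List Bool) :
    Run (p * (2 * a + 3) + 1) (conf (some .mul) i a 0 c p o)
      (conf (some .refill) i a 0 (c + p * a) 0 o) := by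
  induction p generalizing c with
  | zero => rw [zero_mul, zero_mul]; exact run_of_stepAux rfl rfl (by rintro (_ | _) <;> rfl)
  | succ p ih =>
    have h₁ : Run 1 (conf (some .mul) i a 0 c (p + 1) o) (conf (some .add) i a 0 c p o) :=
      run_of_stepAux rfl rfl (by rintro (_ | _) <;> rfl)
    have h₂ := run_add i a 0 c p o
    have h₃ := run_restore i 0 (0 + a) (c + a) p o
    simp only [zero_add] at h₂ h₃
    have h := ((h₁.trans h₂).trans h₃).trans (ih (c + a))
    rw [show c + (p + 1) * a = c + a + p * a by ring]
    exact h.mono (by ring_nf; rfl)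

theorem run_refill (i : List Bool) (a b c p : ℕ) (o : List Bool) :
    Run (c + 1) (conf (some .refill) i a b c p o) (conf (some .power) i a b 0 (p + c) o) := by
  induction c generalizing p with
  | zero => exact run_of_stepAux rfl rfl (by rintro (_ | _) <;> rfl)
  | succ c ih =>
    have h := ih (p + 1)
    rw [Nat.add_right_comm p 1 c] at h
    exact h.cons (run_of_stepAux rfl rfl (by rintro (_ | _) <;> rfl))

theorem run_power (e a p : ℕ) (o : List Bool) {T : ℕ} (ha : 1 ≤ a) (hp : 1 ≤ p)
    (hT : p * a ^ e ≤ T) :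
    Run (e * (9 * T) + 1) (conf (some .power) (List.replicate (e + e) true) a 0 0 p o)
      (conf (some .clear) [] a 0 0 (p * a ^ e) o) := by
  induction e generalizing p with
  | zero =>
    rw [zero_mul, pow_zero, mul_one]
    exact run_of_stepAux rfl rfl (by rintro (_ | _) <;> rfl)
  | succ e ih =>
    have h₁ : Run 1 (conf (some .power) (List.replicate (e + 1 + (e + 1)) true) a 0 0 p o)
        (conf (some .mul) (List.replicate (e + e) true) a 0 0 p o) := by
      rw [show e + 1 + (e + 1) = e + e + 1 + 1 by ring]
      exact run_of_stepAux rfl rfl (by rintro (_ | _) <;> rfl)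
    have h₂ := run_mul (List.replicate (e + e) true) a 0 p o
    have h₃ := run_refill (List.replicate (e + e) true) a 0 (0 + p * a) 0 o
    simp only [zero_add] at h₂ h₃
    rw [pow_succ', ← mul_assoc p a] at hT ⊢
    have hpa : 1 ≤ p * a := Nat.mul_pos hp ha
    refine (((h₁.trans h₂).trans h₃).trans (ih (p * a) hpa hT)).mono ?_
    -- One round costs `3 * p * a + 3 * p + 3`, and each of `p * a`, `p` and `1` is at most `T`;
    -- hence the constant 9.
    have h₄ : p * a ≤ T := (Nat.le_mul_of_pos_right _ (Nat.pow_pos ha)).trans hT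
    have h₅ : p ≤ p * a := Nat.le_mul_of_pos_right _ ha
    nlinarith

theorem run_clear (i : List Bool) (a b c p : ℕ) (o : List Bool) :
    Run (a + 1) (conf (some .clear) i a b c p o) (conf (some .copy) i 0 b c p o) := by
  induction a with
  | zero => exact run_of_stepAux rfl rfl (by rintro (_ | _) <;> rfl)
  | succ a ih =>
    exact ih.cons (run_of_stepAux rfl rfl (by rintro (_ | _) <;> rfl))

theorem run_copy (i : List Bool) (a b c p : ℕ) (o : List Bool) :
    Run (p + 1) (conf (some .copy) i a b c p o)
      (conf (some .row) i a (b + p) (c + p) 0 o) := by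
  induction p generalizing b c with
  | zero => exact run_of_stepAux rfl rfl (by rintro (_ | _) <;> rfl)
  | succ p ih =>
    have h := ih (b + 1) (c + 1)
    rw [Nat.add_right_comm b 1 p, Nat.add_right_comm c 1 p] at h
    exact h.cons (run_of_stepAux rfl rfl (by rintro (_ | _) <;> rfl))

theorem run_zeros (i : List Bool) (a b c p : ℕ) (o : List Bool) :
    Run (b + 1) (conf (some .zeros) i a b c p o)
      (conf (some .back) i a 0 c (p + b) (List.replicate b false ++ o)) := by
  induction b generalizing p o with
  | zero => exact run_of_stepAux rfl rfl (by rintro (_ | _) <;> rfl)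
  | succ b ih =>
    have h := ih (p + 1) (false :: o)
    rw [Nat.add_right_comm p 1 b] at h
    rw [List.replicate_succ', List.append_assoc]
    exact h.cons (run_of_stepAux rfl rfl (by rintro (_ | _) <;> rfl))

theorem run_back (i : List Bool) (a b c p : ℕ) (o : List Bool) :
    Run (p + 1) (conf (some .back) i a b c p o) (conf (some .row) i a (b + p) c 0 o) := by
  induction p generalizing b with
  | zero => exact run_of_stepAux rfl rfl (by rintro (_ | _) <;> rfl)
  | succ p ih =>
    have h := ih (b + 1)
    rw [Nat.add_right_comm b 1 p] at h
    exact h.cons (run_of_stepAux rfl rfl (by rintro (_ | _) <;> rfl))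

/-- The entries `0, …, c (b + 1)` of the list of entries of an identity matrix of
size `b`. -/
def entries (b c : ℕ) : List Bool :=
  (List.range (c * (b + 1) + 1)).map fun k => decide (b + 1 ∣ k)

theorem entries_zero (b : ℕ) : entries b 0 = [true] := by
  simp [entries]

/-- Only multiples of `b + 1` carry a one, so consecutive ones are separated by exactly `b` zeros.
-/
theorem entries_succ (b c : ℕ) :
    entries b (c + 1) = entries b c ++ (List.replicate b false ++ [true]) := by
  have h₁ : (c + 1) * (b + 1) + 1 = c * (b + 1) + 1 + b + 1 := by ring
  have h₂ : c * (b + 1) + 1 + b = (c + 1) * (b + 1) := by ring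
  rw [entries, h₁, List.range_succ, List.range_add, List.map_append, List.map_append,
    List.append_assoc, entries]
  congr 2
  · rw [List.eq_replicate_iff]
    refine ⟨by simp, fun x hx => ?_⟩
    simp only [List.map_map, List.mem_map, List.mem_range, Function.comp_apply] at hx
    obtain ⟨k, hk, rfl⟩ := hx
    rw [decide_eq_false_iff_not, add_assoc, ← Nat.dvd_add_iff_right (Dvd.intro_left c rfl)]
    exact Nat.not_dvd_of_pos_of_lt (by lia) (by lia)
  · rw [h₂]
    simp

/-- The output is a stack, so the last entries are written first; the block pushed in one round is
the one that `entries_succ` splits off at the end. The last round stops right after its one. -/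
theorem run_rows (i : List Bool) (a b c : ℕ) (o : List Bool) :
    Run ((c + 1) * (2 * b + 3)) (conf (some .row) i a b (c + 1) 0 o)
      (conf (some .wipe) i a b 0 0 (entries b c ++ o)) := by
  induction c generalizing o with
  | zero =>
    rw [entries_zero]
    exact Run.mono (by lia) (run_of_stepAux rfl rfl (by rintro (_ | _) <;> rfl))
  | succ c ih =>
    have h₁ : Run 1 (conf (some .row) i a b (c + 1 + 1) 0 o)
        (conf (some .zeros) i a b (c + 1) 0 (true :: o)) :=
      run_of_stepAux rfl rfl (by rintro (_ | _) <;> rfl)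
    have h₂ := run_zeros i a b (c + 1) 0 (true :: o)
    have h₃ := run_back i a 0 (c + 1) (0 + b) (List.replicate b false ++ true :: o)
    simp only [zero_add] at h₂ h₃
    have h := ((h₁.trans h₂).trans h₃).trans (ih _)
    rw [entries_succ, List.append_assoc, List.append_assoc]
    exact h.mono (by ring_nf; rfl)

/-- A halting configuration must have every stack except the output empty, which is the reason for
this phase and for the `clear` phase. -/
theorem run_wipe (i : List Bool) (a b c p : ℕ) (o : List Bool) :
    Run (b + 1) (conf (some .wipe) i a b c p o) (conf none i a 0 c p o) := by
  induction b with
  | zero => exact run_of_stepAux rfl rfl (by rintro (_ | _) <;> rfl)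
  | succ b ih =>
    exact ih.cons (run_of_stepAux rfl rfl (by rintro (_ | _) <;> rfl))

theorem run_main {n e N : ℕ} (hn : 1 ≤ n) (hN : n ^ e = N + 1) :
    Run (2 * n + 5 + e * (9 * (N + 1)) + (N + 1) * (2 * N + 7))
      (conf (some .read) (NCPoly.unaryPair n (e + e)) 0 0 0 0 [])
      (conf none [] 0 0 0 0 (entries (N + 1) N)) := by
  have h₁ := run_read n (List.replicate (e + e) true) 0 0 0 0 []
  have h₂ := run_power e n 1 [] hn le_rfl (T := N + 1) (by rw [hN, one_mul])
  rw [one_mul, hN] at h₂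
  have h₃ := run_clear [] n 0 0 (N + 1) []
  have h₄ := run_copy [] 0 0 0 (N + 1) []
  have h₅ := run_rows [] 0 (N + 1) N []
  have h₆ := run_wipe [] 0 (N + 1) 0 0 (entries (N + 1) N)
  simp only [zero_add, List.append_nil] at h₁ h₄ h₅
  refine (((((h₁.trans h₂).trans h₃).trans h₄).trans h₅).trans h₆).mono ?_
  ring_nf
  rfl

/-- The machine with its input and output alphabets. -/
def computer : TM2ComputableAux Bool Bool where
  tm := machine
  inputAlphabet := Equiv.refl Bool
  outputAlphabet := Equiv.refl Bool

theorem outputsInTime {n e N : ℕ} (hn : 1 ≤ n) (hN : n ^ e = N + 1) :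
    Nonempty (TM2OutputsInTime computer.tm
      ((NCPoly.unaryPair n (e + e)).map computer.inputAlphabet.symm)
      (some ((entries (N + 1) N).map computer.outputAlphabet.symm))
      (2 * n + 5 + e * (9 * (N + 1)) + (N + 1) * (2 * N + 7))) := by
  have hin : initList computer.tm ((NCPoly.unaryPair n (e + e)).map computer.inputAlphabet.symm) =
      conf (some .read) (NCPoly.unaryPair n (e + e)) 0 0 0 0 [] := by
    refine cfg_ext rfl rfl ?_
    rintro (_ | _) <;> first | rfl | exact List.map_id _
  have hout : haltList computer.tm ((entries (N + 1) N).map computer.outputAlphabet.symm) =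
      conf none [] 0 0 0 0 (entries (N + 1) N) := by
    refine cfg_ext rfl rfl ?_
    rintro (_ | _) <;> first | rfl | exact List.map_id _
  rw [TM2OutputsInTime, Option.map_some, hin, hout]
  exact run_main hn hN

end IdentityPrinter

/-! ### The sum of squares: full rank and explicitness. -/

namespace NCPoly

variable {K : Type*} [Field K] {n : ℕ}

theorem word_injective {k : ℕ} : Function.Injective (word : (Fin k → Fin n) → _) := fun _ _ h =>
  List.ofFn_injective (FreeMonoid.ofList.injective h)

theorem length_word {k : ℕ} (w : Fin k → Fin n) : (word w).length = k :=
  List.length_ofFn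

theorem word_mul_word {k l : ℕ} (u : Fin k → Fin n) (v : Fin l → Fin n) :
    word u * word v = word (Fin.append u v) := by
  rw [word, word, word, List.ofFn_fin_append, FreeMonoid.ofList_append]

/-- The sum of the squares of all monomials of degree `e`. -/
noncomputable def sumSquares (K : Type*) [Field K] (n e : ℕ) : NCPoly K n :=
  ∑ u : Fin e → Fin n, MonoidAlgebra.single (word u * word u) 1

theorem coeff_sumSquares_word_mul_word {e : ℕ} (u v : Fin e → Fin n) :
    (sumSquares K n e).coeff (word u * word v) = if u = v then 1 else 0 := by
  have h (w : Fin e → Fin n) : word w * word w = word u * word v ↔ w = u ∧ w = v := by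
    rw [word_mul_word, word_mul_word, word_injective.eq_iff]
    constructor
    · intro h
      exact ⟨funext fun i => by simpa using congrFun h (Fin.castAdd e i),
        funext fun i => by
          simpa only [Fin.append_right] using congrFun h (Fin.natAdd e i)⟩
    · rintro ⟨rfl, rfl⟩
      rfl
  classical
  rw [sumSquares, MonoidAlgebra.coeff_sum, Finsupp.finsetSum_apply]
  simp only [MonoidAlgebra.coeff_single, Finsupp.single_apply, h, ite_and]
  simp

theorem isHomogeneous_sumSquares (e : ℕ) : (sumSquares K n e).IsHomogeneous (e + e) := by
  classical
  intro w hw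
  rw [sumSquares, MonoidAlgebra.coeff_sum, Finsupp.finsetSum_apply] at hw
  obtain ⟨u, -, hu⟩ := Finset.exists_ne_zero_of_sum_ne_zero hw
  rw [MonoidAlgebra.coeff_single, Finsupp.single_apply, ne_eq, ite_eq_right_iff, Classical.not_imp] at hu
  rw [← hu.1, word_mul_word, length_word]

theorem isFullRank_sumSquares (e : ℕ) : (sumSquares K n e).IsFullRank (e + e) := by
  refine ⟨isHomogeneous_sumSquares e, ?_⟩
  -- The column length `(e + e) - (e + e) / 2` is not `e` by definition, so both lengths are
  -- generalized before substituting.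
  have h (k l : ℕ) (hk : k = e) (hl : l = e) : (Matrix.of fun (u : Fin k → Fin n)
      (v : Fin l → Fin n) => (sumSquares K n e).coeff (word u * word v)).rank = n ^ k := by
    subst hk hl
    simp only [coeff_sumSquares_word_mul_word]
    convert Matrix.rank_one (R := K) (n := Fin l → Fin n) using 2
    · ext u v
      rw [Matrix.one_apply]
      rfl
    · simp
  exact h _ _ (by lia) (by lia)

/-- With the lowest digit first, the numeral of a concatenation `u v` is that of `u` plus `n ^ e`
times that of `v`; remainder and quotient by `n ^ e` thus recover the two halves. -/
theorem coeff_sumSquares_digits {e : ℕ} (k : Fin (n ^ (e + e))) :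
    (sumSquares K n e).coeff (word (finFunctionFinEquiv.symm k)) =
      if (k : ℕ) % n ^ e = k / n ^ e then 1 else 0 := by
  obtain ⟨f, rfl⟩ := finFunctionFinEquiv.surjective k
  obtain ⟨⟨u, v⟩, rfl⟩ := (Fin.appendEquiv e e).surjective f
  have hlt (w : Fin e → Fin n) : ∑ i, (w i : ℕ) * n ^ (i : ℕ) < n ^ e :=
    (finFunctionFinEquiv w).is_lt
  have hn : 0 < n ^ e := (Nat.zero_le _).trans_lt (hlt u)
  have hval : ((finFunctionFinEquiv (Fin.append u v) : Fin (n ^ (e + e))) : ℕ) =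
      (finFunctionFinEquiv u : ℕ) + n ^ e * finFunctionFinEquiv v := by
    simp only [finFunctionFinEquiv_apply, Fin.sum_univ_add, Fin.append_left, Fin.append_right,
      Fin.val_castAdd, Fin.val_natAdd, pow_add, Finset.mul_sum]
    congr 1
    exact Finset.sum_congr rfl fun i _ => by ring
  rw [show Fin.appendEquiv e e (u, v) = Fin.append u v from rfl, Equiv.symm_apply_apply, ← word_mul_word,
    coeff_sumSquares_word_mul_word, hval, Nat.add_mul_mod_self_left,
    Nat.mod_eq_of_lt (finFunctionFinEquiv u).is_lt, Nat.add_mul_div_left _ _ hn,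
    Nat.div_eq_of_lt (finFunctionFinEquiv u).is_lt, zero_add]
  exact if_congr (by rw [← Fin.ext_iff, finFunctionFinEquiv.injective.eq_iff]) rfl rfl

end NCPoly

/-- If `k = N * q + r` with `r = q`, then `k = (N + 1) * q`. Conversely `k < N * N` forces `q < N`,
so that `q` is a legitimate remainder. -/
theorem Nat.mod_eq_div_iff_succ_dvd {N k : ℕ} (hk : k < N * N) :
    k % N = k / N ↔ N + 1 ∣ k := by
  have hN : 0 < N := Nat.pos_of_ne_zero (by rintro rfl; simp at hk)
  constructor
  · intro h
    refine ⟨k / N, ?_⟩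
    have := Nat.div_add_mod k N
    rw [h] at this
    linarith
  · rintro ⟨q, rfl⟩
    have hq : q < N := by
      by_contra! h
      have := Nat.mul_le_mul (Nat.le_succ N) h
      lia
    rw [add_mul, one_mul, add_comm, Nat.add_mul_mod_self_left, Nat.mod_eq_of_lt hq,
      Nat.add_mul_div_left _ _ hN, Nat.div_eq_of_lt hq, zero_add]

theorem IdentityPrinter.entries_eq_ofFn {N M : ℕ} (hM : M = (N + 1) * (N + 1)) :
    entries (N + 1) N = List.ofFn fun k : Fin M => decide ((k : ℕ) % (N + 1) = k / (N + 1)) := by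
  subst hM
  rw [entries, show N * (N + 1 + 1) + 1 = (N + 1) * (N + 1) by ring]
  refine List.ext_getElem (by rw [List.length_map, List.length_range, List.length_ofFn])
    fun k hk _ => ?_
  have : k < (N + 1) * (N + 1) := by rwa [List.length_map, List.length_range] at hk
  rw [List.getElem_ofFn, List.getElem_map, List.getElem_range]
  simp only [Nat.mod_eq_div_iff_succ_dvd this]

theorem NCPoly.isExplicitFamily_sumSquares (K : Type*) [Field K] :
    IsExplicitFamily fun n d => sumSquares K n (d / 2) := by
  -- The square absorbs the `e` multiplication rounds of cost `9 * n ^ e`; all remaining terms are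
  -- linear in `n` and in the output length `(n ^ e) ^ 2`.
  refine ⟨IdentityPrinter.computer, 9 * Polynomial.X ^ 2 + 14 * Polynomial.X, ?_⟩
  rintro n d hn - ⟨e, rfl⟩
  beta_reduce
  rw [show (e + e) / 2 = e by lia]
  obtain ⟨N, hN⟩ : ∃ N, n ^ e = N + 1 := Nat.exists_eq_add_one.2 (Nat.pow_pos hn)
  have hM : n ^ (e + e) = (N + 1) * (N + 1) := by rw [pow_add, hN]
  refine ⟨isHomogeneous_sumSquares e,
    fun k => decide ((k : ℕ) % (N + 1) = k / (N + 1)), fun k => ?_, ?_⟩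
  · simp only [coeff_sumSquares_digits, hN, decide_eq_true_eq]
  · obtain ⟨h⟩ := IdentityPrinter.outputsInTime hn hN
    rw [IdentityPrinter.entries_eq_ofFn hM] at h
    refine ⟨⟨h.toEvalsTo, h.steps_le_m.trans ?_⟩⟩
    have hlen : (unaryPair n (e + e)).length = n + (e + e) + 1 := by
      simp [unaryPair]
      ring
    simp only [Polynomial.eval_add, Polynomial.eval_mul, Polynomial.eval_pow, Polynomial.eval_X,
      Polynomial.eval_ofNat, hlen, hM]
    nlinarith [Nat.zero_le (e * n), Nat.zero_le (e * N), Nat.zero_le (e * (N * N)),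
      Nat.zero_le (n * N)]

/-! ### Rank bounds -/

namespace Matrix

variable {K : Type*} [Field K] {m n X : Type*} [Fintype n] [Fintype X]

theorem rank_add_le (A B : Matrix m n K) : (A + B).rank ≤ A.rank + B.rank := by
  rw [rank, rank, rank, mulVecLin_add]
  refine (Submodule.finrank_mono (LinearMap.range_add_le _ _)).trans ?_
  exact Submodule.finrank_add_le_finrank_add_finrank _ _

theorem rank_sum_le {ι : Type*} (s : Finset ι) (A : ι → Matrix m n K) :
    (∑ i ∈ s, A i).rank ≤ ∑ i ∈ s, (A i).rank :=
  Finset.le_sum_of_subadditive (fun M : Matrix m n K => M.rank) rank_zero.le rank_add_le s A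

/-- Up to the scalar `g u`, row `u` depends only on `π u`, so the matrix factors through a space
with basis `X`. -/
theorem rank_le_card_of_row_factor (π : m → X) (g : m → K) (h : X → n → K) :
    (Matrix.of fun u v => g u * h (π u) v).rank ≤ Fintype.card X := by
  classical
  have : (Matrix.of fun u v => g u * h (π u) v) =
      (Matrix.of fun u x => if π u = x then g u else 0 : Matrix m X K) * Matrix.of h := by
    ext u v
    simp [Matrix.mul_apply]
  rw [this]
  exact (rank_mul_le_left _ _).trans (rank_le_card_width _)

theorem rank_le_card_of_col_factor [Fintype m] (π : n → X) (g : n → K) (h : m → X → K) :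
    (Matrix.of fun u v => h u (π v) * g v).rank ≤ Fintype.card X := by
  rw [← rank_transpose]
  convert rank_le_card_of_row_factor π g fun x u => h u x using 2
  ext v u
  simp [mul_comm]

end Matrix

/-! ### Coefficients of products -/

namespace NCPoly

variable {K : Type*} [Field K] {n : ℕ}

/-- The coefficient of the monomial with the given list of indices. -/
def coeffList (f : NCPoly K n) (w : List (Fin n)) : K :=
  f.coeff (FreeMonoid.ofList w)

theorem coeffList_add (f g : NCPoly K n) (w : List (Fin n)) :
    (f + g).coeffList w = f.coeffList w + g.coeffList w := by
  simp [coeffList]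

theorem coeffList_sum {ι : Type*} (s : Finset ι) (f : ι → NCPoly K n) (w : List (Fin n)) :
    (∑ i ∈ s, f i).coeffList w = ∑ i ∈ s, (f i).coeffList w := by
  simp [coeffList, MonoidAlgebra.coeff_sum, Finsupp.finsetSum_apply]

theorem coeffList_smul (c : K) (f : NCPoly K n) (w : List (Fin n)) :
    (c • f).coeffList w = c * f.coeffList w := by
  simp [coeffList]

theorem coeffList_mul (f g : NCPoly K n) (w : List (Fin n)) :
    (f * g).coeffList w =
      ∑ i ∈ Finset.range (w.length + 1), f.coeffList (w.take i) * g.coeffList (w.drop i) := by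
  classical
  have hinj : Set.InjOn (fun i => (FreeMonoid.ofList (w.take i), FreeMonoid.ofList (w.drop i)))
      (Finset.range (w.length + 1)) := by
    intro i hi j hj h
    have := congrArg List.length (FreeMonoid.ofList.injective (Prod.ext_iff.1 h).1)
    simp only [Finset.coe_range, Set.mem_Iio, List.length_take] at hi hj this
    lia
  rw [coeffList, MonoidAlgebra.coeff_mul_antidiag f g _ (Finset.image
    (fun i => (FreeMonoid.ofList (w.take i), FreeMonoid.ofList (w.drop i)))
    (Finset.range (w.length + 1))), Finset.sum_image hinj]
  · rfl
  · rintro ⟨x, y⟩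
    simp only [Finset.mem_image, Finset.mem_range, Prod.mk.injEq]
    constructor
    · rintro ⟨i, -, rfl, rfl⟩
      rw [← FreeMonoid.ofList_append, List.take_append_drop]
    · intro h
      obtain rfl : x.toList ++ y.toList = w := h
      refine ⟨x.toList.length, by simp, ?_, ?_⟩
      · rw [List.take_left]; rfl
      · rw [List.drop_left]; rfl

theorem coeffList_one (w : List (Fin n)) :
    (1 : NCPoly K n).coeffList w = if w.length = 0 then 1 else 0 := by
  classical
  rw [coeffList, MonoidAlgebra.one_def, MonoidAlgebra.coeff_single, Finsupp.single_apply]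
  refine if_congr ?_ rfl rfl
  rw [List.length_eq_zero_iff]
  exact eq_comm

/-- The part of `f` of degree less than `k`. -/
noncomputable def truncate (k : ℕ) (f : NCPoly K n) : NCPoly K n :=
  MonoidAlgebra.ofCoeff (f.coeff.filter fun w => w.length < k)

theorem coeffList_truncate (k : ℕ) (f : NCPoly K n) (w : List (Fin n)) :
    (f.truncate k).coeffList w = if w.length < k then f.coeffList w else 0 := by
  rw [coeffList, truncate, MonoidAlgebra.coeff_ofCoeff, Finsupp.filter_apply]
  rfl

theorem coeffList_eq_zero_of_homogeneousPart {f : NCPoly K n} {w : List (Fin n)}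
    (h : f.homogeneousPart w.length = 0) : f.coeffList w = 0 := by
  have := congrArg (fun g : NCPoly K n => g.coeffList w) h
  simp only [coeffList, homogeneousPart, MonoidAlgebra.coeff_ofCoeff] at this
  rw [Finsupp.filter_apply, if_pos (by rfl)] at this
  exact this

theorem coeffList_X_eq_zero (i : Fin n) {w : List (Fin n)} (hw : w.length ≠ 1) :
    (X i : NCPoly K n).coeffList w = 0 := by
  classical
  rw [coeffList, X, MonoidAlgebra.coeff_single, Finsupp.single_apply, if_neg]
  intro h
  apply hw
  rw [← FreeMonoid.toList_ofList w, ← h]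
  rfl

/-- Inverting `1 - E` over the noncommutative polynomials: every coefficient of `G = (1 - E)⁻¹` of
degree at least `k` is obtained by splitting at the factor `E` that crosses position `k`. -/
theorem coeffList_inverse_split {ι : Type*} [Fintype ι] [DecidableEq ι]
    {E G : Matrix ι ι (NCPoly K n)} (hl : (1 - E) * G = 1) (hr : G * (1 - E) = 1)
    {k : ℕ} (hk : 1 ≤ k) (s t : ι) {w : List (Fin n)} (hw : k ≤ w.length) :
    (G s t).coeffList w = ∑ i ∈ Finset.Icc k w.length, ∑ a ∈ Finset.range k, ∑ q, ∑ p,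
      (G s p).coeffList (w.take a) * (E p q).coeffList ((w.take i).drop a) *
        (G q t).coeffList (w.drop i) := by
  -- `A` collects the prefixes still shorter than `k`. The correction `R` in `G = A + R * G` turns
  -- out to be the part of `A * E` of degree at least `k`: a short prefix followed by the crossing
  -- factor.
  set A : Matrix ι ι (NCPoly K n) := G.map (truncate k) with hA
  set R : Matrix ι ι (NCPoly K n) := 1 - A * (1 - E) with hR
  have hcA (p q : ι) (x : List (Fin n)) :
      (A p q).coeffList x = if x.length < k then (G p q).coeffList x else 0 :=
    coeffList_truncate _ _ _
  have hG : G = A + R * G := by rw [hR, sub_mul, mul_assoc, hl]; simp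
  have hRA : R + A = 1 + A * E := by rw [hR, mul_sub, mul_one]; abel
  have hGE : G = 1 + G * E := by
    rw [mul_sub, mul_one, sub_eq_iff_eq_add] at hr
    exact hr
  have hone (p q : ι) (x : List (Fin n)) : ((1 : Matrix ι ι (NCPoly K n)) p q).coeffList x =
      if x.length = 0 then ((1 : Matrix ι ι (NCPoly K n)) p q).coeffList x else 0 := by
    by_cases hpq : p = q
    · subst hpq
      rw [Matrix.one_apply_eq, coeffList_one]
      split_ifs <;> rfl
    · rw [Matrix.one_apply_ne hpq]
      simp [coeffList]
  have hRc (p q : ι) (x : List (Fin n)) : (R p q).coeffList x = if x.length < k then 0 else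
      ∑ a ∈ Finset.range k, ∑ r, (G p r).coeffList (x.take a) * (E r q).coeffList (x.drop a) := by
    have h₁ := congrArg (fun M : Matrix ι ι (NCPoly K n) => (M p q).coeffList x) hRA
    simp only [Matrix.add_apply, coeffList_add, hcA, Matrix.mul_apply, coeffList_sum,
      coeffList_mul] at h₁
    split_ifs at h₁ ⊢ with hx
    -- Below degree `k` the truncation is invisible: `1 + A * E` agrees there with `1 + G * E = G`,
    -- hence with `A`, so `R` vanishes.
    · have h₂ := congrArg (fun M : Matrix ι ι (NCPoly K n) => (M p q).coeffList x) hGE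
      simp only [Matrix.add_apply, coeffList_add, Matrix.mul_apply, coeffList_sum,
        coeffList_mul] at h₂
      rw [h₂] at h₁
      have : ∀ r, ∀ i ∈ Finset.range (x.length + 1),
          (if (x.take i).length < k then (G p r).coeffList (x.take i) else 0) *
            (E r q).coeffList (x.drop i) =
          (G p r).coeffList (x.take i) * (E r q).coeffList (x.drop i) := by
        intro r i _
        rw [if_pos]
        rw [List.length_take]
        lia
      rw [Finset.sum_congr rfl fun r _ => Finset.sum_congr rfl (this r)] at h₁
      simpa using h₁
    · rw [add_zero, hone, if_neg (by lia), zero_add] at h₁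
      rw [h₁, Finset.sum_comm]
      symm
      apply Finset.sum_subset_zero_on_sdiff (Finset.range_subset_range.2 (by lia))
      · intro i hi
        simp only [Finset.mem_sdiff, Finset.mem_range] at hi
        refine Finset.sum_eq_zero fun r _ => ?_
        rw [if_neg (by rw [List.length_take]; lia), zero_mul]
      · intro i hi
        rw [Finset.mem_range] at hi
        refine Finset.sum_congr rfl fun r _ => ?_
        rw [if_pos (by rw [List.length_take]; lia)]
  have h := congrArg (fun M : Matrix ι ι (NCPoly K n) => (M s t).coeffList w) hG
  simp only [Matrix.add_apply, coeffList_add, hcA, Matrix.mul_apply, coeffList_sum,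
    coeffList_mul] at h
  rw [if_neg (by lia), zero_add, Finset.sum_comm] at h
  rw [h]
  symm
  apply Finset.sum_subset_zero_on_sdiff
  · intro i hi
    rw [Finset.mem_Icc] at hi
    rw [Finset.mem_range]
    lia
  · intro i hi
    simp only [Finset.mem_sdiff, Finset.mem_range, Finset.mem_Icc] at hi
    refine Finset.sum_eq_zero fun r _ => ?_
    rw [hRc, if_pos (by rw [List.length_take]; lia), zero_mul]
  · intro i hi
    rw [Finset.mem_Icc] at hi
    rw [Finset.sum_comm]
    refine Finset.sum_congr rfl fun q _ => ?_
    rw [hRc, if_neg (by rw [List.length_take]; lia), Finset.sum_mul]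
    refine Finset.sum_congr rfl fun a ha => ?_
    rw [Finset.mem_range] at ha
    rw [Finset.sum_mul]
    refine Finset.sum_congr rfl fun p _ => ?_
    rw [List.take_take, min_eq_left (by lia)]

/-- A factor `E` of degree `b` in the middle of words of length `k + l` contributes a matrix of rank
at most `n ^ (b / 2)`. -/
theorem rank_split_le {k l i a : ℕ} (ha : a ≤ k) (hi : k ≤ i) (hil : i ≤ k + l)
    (P E Q : NCPoly K n) (hn : 1 ≤ n) :
    (Matrix.of fun (u : Fin k → Fin n) (v : Fin l → Fin n) =>
      P.coeffList ((List.ofFn u ++ List.ofFn v).take a) *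
        E.coeffList (((List.ofFn u ++ List.ofFn v).take i).drop a) *
        Q.coeffList ((List.ofFn u ++ List.ofFn v).drop i)).rank ≤ n ^ ((i - a) / 2) := by
  obtain ⟨j, rfl⟩ := Nat.exists_eq_add_of_le hi
  obtain ⟨b, rfl⟩ := Nat.exists_eq_add_of_le ha
  obtain ⟨c, rfl⟩ : ∃ c, l = j + c := Nat.exists_eq_add_of_le (by lia)
  have hu (u : Fin (a + b) → Fin n) : List.ofFn u =
      List.ofFn (fun i => u (Fin.castAdd b i)) ++ List.ofFn (fun i => u (Fin.natAdd a i)) := by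
    rw [← List.ofFn_fin_append, Fin.append_castAdd_natAdd]
  have hv (v : Fin (j + c) → Fin n) : List.ofFn v =
      List.ofFn (fun i => v (Fin.castAdd c i)) ++ List.ofFn (fun i => v (Fin.natAdd j i)) := by
    rw [← List.ofFn_fin_append, Fin.append_castAdd_natAdd]
  have key (u : Fin (a + b) → Fin n) (v : Fin (j + c) → Fin n) :
      P.coeffList ((List.ofFn u ++ List.ofFn v).take a) *
        E.coeffList (((List.ofFn u ++ List.ofFn v).take (a + b + j)).drop a) *
        Q.coeffList ((List.ofFn u ++ List.ofFn v).drop (a + b + j)) =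
      P.coeffList (List.ofFn fun i => u (Fin.castAdd b i)) *
        E.coeffList (List.ofFn (fun i => u (Fin.natAdd a i)) ++
          List.ofFn (fun i => v (Fin.castAdd c i))) *
        Q.coeffList (List.ofFn fun i => v (Fin.natAdd j i)) := by
    rw [hu u, hv v]
    simp [List.take_append, List.drop_append, List.take_of_length_le, add_assoc,
      List.drop_eq_nil_of_le]
  simp only [key]
  have hcard (r : ℕ) : Fintype.card (Fin r → Fin n) = n ^ r := by
    rw [Fintype.card_fun, Fintype.card_fin, Fintype.card_fin]
  -- The middle factor sees the last `b` letters of `u` and the first `j` letters of `v`, with `b +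
  -- j = i - a`. Factoring through the shorter of the two gives an exponent of at most half of `i -
  -- a`.
  rcases le_total b j with h | h
  · refine le_trans ?_ (Nat.pow_le_pow_right hn (show b ≤ _ by lia))
    refine le_trans (le_of_eq ?_) ((Matrix.rank_le_card_of_row_factor
      (fun (u : Fin (a + b) → Fin n) i => u (Fin.natAdd a i))
      (fun u => P.coeffList (List.ofFn fun i => u (Fin.castAdd b i)))
      (fun x (v : Fin (j + c) → Fin n) => E.coeffList (List.ofFn x ++
          List.ofFn (fun i => v (Fin.castAdd c i))) *
        Q.coeffList (List.ofFn fun i => v (Fin.natAdd j i)))).trans_eq (hcard b))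
    exact congrArg Matrix.rank (Matrix.ext fun u v => mul_assoc _ _ _)
  · refine le_trans ?_ (Nat.pow_le_pow_right hn (show j ≤ _ by lia))
    exact (Matrix.rank_le_card_of_col_factor
      (fun (v : Fin (j + c) → Fin n) i => v (Fin.castAdd c i))
      (fun v => Q.coeffList (List.ofFn fun i => v (Fin.natAdd j i)))
      (fun (u : Fin (a + b) → Fin n) x => P.coeffList (List.ofFn fun i => u (Fin.castAdd b i)) *
        E.coeffList (List.ofFn (fun i => u (Fin.natAdd a i)) ++ List.ofFn x))).trans_eq (hcard j)

end NCPoly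

/-! ### Branching programs as inverses of `1 - E`, and the size bound. -/

namespace HelpABP

open Finset

variable {K : Type*} [Field K] {n m : ℕ}

open Classical in
/-- The weighted adjacency matrix of a program. -/
noncomputable def edgeMatrix (A : HelpABP K n m) (h : Fin m → NCPoly K n) :
    Matrix (Fin A.size) (Fin A.size) (NCPoly K n) :=
  Matrix.of fun u v => if A.Adj u v then A.edgePoly h u v else 0

open Classical in
theorem edgeMatrix_apply (A : HelpABP K n m) (h : Fin m → NCPoly K n) (u v : Fin A.size) :
    A.edgeMatrix h u v = if A.Adj u v then A.edgePoly h u v else 0 :=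
  rfl

theorem isPath_cons {A : HelpABP K n m} {u v x : Fin A.size} {l : ℕ}
    {p : Fin (l + 1) → Fin A.size} :
    A.IsPath u v (Fin.cons x p : Fin (l + 2) → Fin A.size) ↔
      x = u ∧ A.Adj u (p 0) ∧ A.IsPath (p 0) v p := by
  constructor
  · rintro ⟨rfl, h₁, h₂⟩
    exact ⟨rfl, h₂ 0, rfl, h₁, fun i => h₂ i.succ⟩
  · rintro ⟨rfl, h₁, -, h₂, h₃⟩
    exact ⟨rfl, h₂, Fin.cases h₁ h₃⟩

theorem pathPoly_cons (A : HelpABP K n m) (h : Fin m → NCPoly K n) (x : Fin A.size) {l : ℕ}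
    (p : Fin (l + 1) → Fin A.size) :
    A.pathPoly h (Fin.cons x p : Fin (l + 2) → Fin A.size) =
      A.edgePoly h x (p 0) * A.pathPoly h p := by
  rw [pathPoly, List.ofFn_succ, List.prod_cons]
  rfl

-- Matrix powers enumerate paths by length; the induction splits off the first vertex of the path.
open Classical in
theorem edgeMatrix_pow_apply (A : HelpABP K n m) (h : Fin m → NCPoly K n) (l : ℕ)
    (u v : Fin A.size) : (A.edgeMatrix h ^ l) u v =
      ∑ p : Fin (l + 1) → Fin A.size with A.IsPath u v p, A.pathPoly h p := by
  induction l generalizing u with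
  | zero =>
    rw [pow_zero, Matrix.one_apply, sum_filter, ← (Equiv.funUnique (Fin 1) _).symm.sum_comp]
    have hp (x : Fin A.size) : A.IsPath (l := 0) u v ((Equiv.funUnique (Fin 1) _).symm x) ↔
        x = u ∧ u = v := by
      constructor
      · rintro ⟨h₁, h₂, -⟩
        exact ⟨h₁, h₁.symm.trans h₂⟩
      · rintro ⟨rfl, rfl⟩
        exact ⟨rfl, rfl, fun i => i.elim0⟩
    simp only [hp, ite_and, sum_ite_eq', mem_univ, if_true]
    rfl
  | succ l ih =>
    have hcons : (∑ p : Fin (l + 2) → Fin A.size,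
          if A.IsPath u v p then A.pathPoly h p else 0) =
        ∑ p : Fin (l + 1) → Fin A.size, if A.Adj u (p 0) then
          (if A.IsPath (p 0) v p then A.edgePoly h u (p 0) * A.pathPoly h p else 0) else 0 := by
      rw [← (Fin.consEquiv fun _ : Fin (l + 2) => Fin A.size).sum_comp, Fintype.sum_prod_type,
        sum_eq_single u]
      · refine sum_congr rfl fun p _ => ?_
        change (if A.IsPath u v (Fin.cons u p) then A.pathPoly h (Fin.cons u p) else 0) = _
        simp only [pathPoly_cons, isPath_cons, true_and, ite_and]
      · exact fun x _ hx => sum_eq_zero fun p _ => if_neg fun h' => hx (isPath_cons.1 h').1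
      · exact fun h' => absurd (mem_univ u) h'
    rw [pow_succ', Matrix.mul_apply, sum_filter, hcons]
    simp only [ih, edgeMatrix_apply, ite_mul, zero_mul, mul_sum, sum_filter, mul_ite, mul_zero]
    rw [sum_comm]
    refine sum_congr rfl fun p _ => ?_
    rw [sum_eq_single (p 0) (fun q _ hq => if_neg fun h' => hq h'.1.symm)
      (fun h' => absurd (mem_univ _) h')]
    split_ifs <;> rfl

theorem polyBetween_eq (A : HelpABP K n m) (h : Fin m → NCPoly K n) (u v : Fin A.size) :
    A.polyBetween h u v = (∑ l ∈ range A.size, A.edgeMatrix h ^ l) u v := by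
  classical
  simp only [polyBetween, Matrix.sum_apply, edgeMatrix_pow_apply]

/-- By acyclicity no path has `size` edges, so the geometric series is a two-sided inverse of `1 -
E`. -/
theorem edgeMatrix_pow_size (A : HelpABP K n m) (h : Fin m → NCPoly K n) :
    A.edgeMatrix h ^ A.size = 0 := by
  classical
  ext1 u v
  rw [edgeMatrix_pow_apply, filter_false_of_mem fun p _ hp => hp.length_lt.false, sum_empty]
  rfl

theorem coeffList_edgeMatrix_eq_zero (A : HelpABP K n m) {h : Fin m → NCPoly K n}
    {w : List (Fin n)} (hw : 2 ≤ w.length) (hh : ∀ j, (h j).homogeneousPart w.length = 0)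
    (u v : Fin A.size) : (A.edgeMatrix h u v).coeffList w = 0 := by
  rw [edgeMatrix_apply]
  split_ifs
  · simp only [edgePoly, NCPoly.coeffList_add, NCPoly.coeffList_sum, NCPoly.coeffList_smul,
      NCPoly.coeffList_X_eq_zero _ (show w.length ≠ 1 by lia),
      NCPoly.coeffList_eq_zero_of_homogeneousPart (hh _), mul_zero, sum_const_zero, add_zero]
  · simp [NCPoly.coeffList]

/-- If the help polynomials have no homogeneous parts of degree greater than `B` up to `k + l`,
except possibly in degrees `0` and `1`, then every polynomial computed with few vertices has a
coefficient matrix of small rank. -/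
theorem rank_commMatrix_polyBetween_le (A : HelpABP K n m) {h : Fin m → NCPoly K n} {d k B : ℕ}
    (hn : 1 ≤ n) (hk : 1 ≤ k) (hkd : k ≤ d)
    (hB : ∀ j i, 2 ≤ i → i ≤ d → (h j).homogeneousPart i ≠ 0 → i ≤ B) (s t : Fin A.size) :
    ((A.polyBetween h s t).commMatrix d k).rank ≤
      (d - k + 1) * k * A.size ^ 2 * n ^ (B / 2) := by
  classical
  set E := A.edgeMatrix h with hE
  set G := ∑ l ∈ range A.size, E ^ l with hG
  have hl : (1 - E) * G = 1 := by
    rw [hG, mul_neg_geom_sum, hE, edgeMatrix_pow_size, sub_zero]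
  have hr : G * (1 - E) = 1 := by
    rw [hG, geom_sum_mul_neg, hE, edgeMatrix_pow_size, sub_zero]
  obtain ⟨l, rfl⟩ := Nat.exists_eq_add_of_le hkd
  let T (i a : ℕ) (q p : Fin A.size) : Matrix (Fin k → Fin n) (Fin (k + l - k) → Fin n) K :=
    Matrix.of fun u v =>
      (G s p).coeffList ((List.ofFn u ++ List.ofFn v).take a) *
        (E p q).coeffList (((List.ofFn u ++ List.ofFn v).take i).drop a) *
        (G q t).coeffList ((List.ofFn u ++ List.ofFn v).drop i)
  have hsplit : (A.polyBetween h s t).commMatrix (k + l) k =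
      ∑ i ∈ Icc k (k + l), ∑ a ∈ range k, ∑ q, ∑ p, T i a q p := by
    ext u v
    have := NCPoly.coeffList_inverse_split hl hr hk s t (w := List.ofFn u ++ List.ofFn v)
      (by simp)
    rw [show (List.ofFn u ++ List.ofFn v).length = k + l by simp] at this
    simp only [Matrix.sum_apply]
    rw [polyBetween_eq]
    exact this
  have hT : ∀ i ∈ Icc k (k + l), ∀ a ∈ range k, ∀ q p, (T i a q p).rank ≤ n ^ (B / 2) := by
    intro i hi a ha q p
    rw [mem_Icc] at hi
    rw [mem_range] at ha
    -- Either the middle coefficient vanishes identically, or its degree is at most 1 (exponent 0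
    -- after halving), or it is a degree present in some help polynomial and so at most `B`.
    by_cases hz : 2 ≤ i - a ∧ ∀ j, (h j).homogeneousPart (i - a) = 0
    · have : T i a q p = 0 := by
        ext u v
        have hlen : (((List.ofFn u ++ List.ofFn v).take i).drop a).length = i - a := by
          simp
          lia
        change _ * (E p q).coeffList _ * _ = (0 : K)
        rw [coeffList_edgeMatrix_eq_zero A (by rw [hlen]; exact hz.1)
          (by rw [hlen]; exact hz.2), mul_zero, zero_mul]
      rw [this, Matrix.rank_zero]
      exact Nat.zero_le _
    · refine (NCPoly.rank_split_le ha.le hi.1 (by lia) _ _ _ hn).trans ?_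
      apply Nat.pow_le_pow_right hn
      rcases lt_or_ge (i - a) 2 with h2 | h2
      · lia
      · simp only [not_and, not_forall] at hz
        obtain ⟨j, hj⟩ := hz h2
        exact Nat.div_le_div_right (hB j _ h2 (by lia) hj)
  rw [hsplit]
  calc _ ≤ ∑ i ∈ Icc k (k + l), ∑ a ∈ range k, ∑ q : Fin A.size, ∑ p : Fin A.size,
        n ^ (B / 2) := by
        refine (Matrix.rank_sum_le _ _).trans (sum_le_sum fun i hi => ?_)
        refine (Matrix.rank_sum_le _ _).trans (sum_le_sum fun a ha => ?_)
        refine (Matrix.rank_sum_le _ _).trans (sum_le_sum fun q _ => ?_)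
        exact (Matrix.rank_sum_le _ _).trans (sum_le_sum fun p _ => hT i hi a ha q p)
    _ = _ := by
      simp only [sum_const, card_univ, Fintype.card_fin, Nat.card_Icc, card_range, smul_eq_mul]
      rw [show k + l + 1 - k = k + l - k + 1 by lia]
      ring

/-- Full-rank polynomials need large programs, whatever the help polynomials of degree at most
`(1 - ε) d` are. -/
theorem le_size_of_isFullRank (A : HelpABP K n m) {h : Fin m → NCPoly K n} {d : ℕ} {f : NCPoly K n}
    (hn : 1 ≤ n) (hm : 1 ≤ m) (hd : 2 ≤ d) (heven : Even d) (hf : f.IsFullRank d) {ε : ℝ}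
    (hε : ε ≤ 1)
    (hh : ∀ (j : Fin m) (i : ℕ), 2 ≤ i → i ≤ d →
      (h j).homogeneousPart i ≠ 0 → (i : ℝ) ≤ d * (1 - ε))
    (hA : A.Computes h f) :
    (n : ℝ) ^ (ε * d / 4) / (√(2 * m) * d * (d + 1)) ≤ A.size := by
  obtain ⟨e, rfl⟩ := heven
  have he : 1 ≤ e := by lia
  have hn' : (1 : ℝ) ≤ n := by exact_mod_cast hn
  have hm' : (1 : ℝ) ≤ m := by exact_mod_cast hm
  have he' : (1 : ℝ) ≤ e := by exact_mod_cast he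
  have hpos : 0 ≤ ((e + e : ℕ) : ℝ) * (1 - ε) := mul_nonneg (Nat.cast_nonneg _) (by linarith)
  set B := ⌊((e + e : ℕ) : ℝ) * (1 - ε)⌋₊ with hB
  have hrank := A.rank_commMatrix_polyBetween_le (d := e + e) (k := e) (B := B) hn he (by lia)
    (fun j i h₁ h₂ h₃ => Nat.le_floor (hh j i h₁ h₂ h₃)) A.source A.sink
  have hfull := hf.2
  rw [show (e + e) / 2 = e by lia] at hfull
  rw [show A.polyBetween h A.source A.sink = f from hA, hfull, Nat.add_sub_cancel] at hrank
  have hBle : ((B / 2 : ℕ) : ℝ) ≤ e * (1 - ε) := by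
    have h₁ : ((B / 2 : ℕ) : ℝ) ≤ B / 2 := Nat.cast_div_le
    have h₂ := Nat.floor_le hpos
    rw [← hB] at h₂
    push_cast at h₂
    linarith
  have hreal : (n : ℝ) ^ (e : ℝ) ≤ (e + 1) * e * A.size ^ 2 * (n : ℝ) ^ ((e : ℝ) * (1 - ε)) := by
    rw [Real.rpow_natCast]
    calc (n : ℝ) ^ e ≤ (e + 1) * e * A.size ^ 2 * (n : ℝ) ^ (B / 2) := by exact_mod_cast hrank
      _ ≤ _ := by
        rw [← Real.rpow_natCast (n : ℝ) (B / 2)]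
        gcongr
  set x := (n : ℝ) ^ (ε * ((e + e : ℕ) : ℝ) / 4) with hx
  -- With `d = 2 * e`, `x ^ 2 = n ^ (ε * e)`, which is what remains of `n ^ e` after division by `n
  -- ^ (e * (1 - ε))`.
  have hx2 : x ^ 2 ≤ (e + 1) * e * A.size ^ 2 := by
    have h₁ : (n : ℝ) ^ (e : ℝ) = x ^ 2 * (n : ℝ) ^ ((e : ℝ) * (1 - ε)) := by
      rw [hx, ← Real.rpow_natCast, ← Real.rpow_mul (by linarith), ← Real.rpow_add (by linarith)]
      congr 1
      push_cast
      ring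
    rw [h₁] at hreal
    exact le_of_mul_le_mul_right hreal (by positivity)
  rw [div_le_iff₀ (by positivity)]
  refine le_of_sq_le_sq ?_ (by positivity)
  refine hx2.trans ?_
  have hs : √(2 * m) ^ 2 = 2 * m := Real.sq_sqrt (by positivity)
  have : (A.size * (√(2 * m) * ((e + e : ℕ) : ℝ) * (((e + e : ℕ) : ℝ) + 1))) ^ 2 =
      (2 * m) * (((e + e : ℝ)) * ((e + e) + 1)) ^ 2 * A.size ^ 2 := by
    rw [mul_pow, mul_pow, mul_pow, hs]
    push_cast
    ring
  rw [this]
  refine mul_le_mul_of_nonneg_right ?_ (sq_nonneg _)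
  -- The claimed denominator is far from tight: `(e + 1) * e ≤ d * (d + 1)` already suffices, and
  -- squaring or multiplying by `2 * m` only increases the right side.
  have h₁ : (e + 1) * e ≤ ((e + e : ℝ)) * ((e + e) + 1) := by nlinarith
  have h₂ : 1 ≤ ((e + e : ℝ)) * ((e + e) + 1) := by nlinarith
  nlinarith

end HelpABP

theorem corollary5p4 {K : Type*} [Field K] :
    ∃ F : ∀ n _d : ℕ, NCPoly K n,
      NCPoly.IsExplicitFamily F ∧
      ∀ n d : ℕ, 1 ≤ n → 2 ≤ d → Even d →
        (F n d).IsFullRank d ∧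
        ∀ (m : ℕ) (_ : 1 ≤ m) (h : Fin m → NCPoly K n) (ε : ℝ), 0 < ε → ε ≤ 1 →
          (∀ (j : Fin m) (i : ℕ), 2 ≤ i → i ≤ d →
            (h j).homogeneousPart i ≠ 0 → (i : ℝ) ≤ d * (1 - ε)) →
          ∀ A : HelpABP K n m, A.Computes h (F n d) →
            (n : ℝ) ^ (ε * d / 4) / (√(2 * m) * d * (d + 1)) ≤ A.size := by
  refine ⟨_, NCPoly.isExplicitFamily_sumSquares K, fun n d hn hd heven => ?_⟩
  have hfull : (NCPoly.sumSquares K n (d / 2)).IsFullRank d := by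
    obtain ⟨e, rfl⟩ := heven
    rw [show (e + e) / 2 = e by lia]
    exact NCPoly.isFullRank_sumSquares e
  exact ⟨hfull, fun m hm h ε _ hε hh A hA =>
    A.le_size_of_isFullRank hn hm hd heven hfull hε hh hA⟩
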